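/- Let $\mathbb R\langle x\rangle$ be the free associative $\mathbb R$-algebra on $x=(x_1,\dots,x_g)$; its elements are called nc polynomials, and the degree of a nonzero one is the length of its longest word. Let ${}^{\intercal}$ be the involution that reverses words and fixes each $x_i$; $p$ is symmetric if $p^{\intercal}=p$. Write $(\mathbb S^{n\times n})^g$ for the set of $g$-tuples of symmetric real $n\times n$ matrices, $n\ge 1$. For $X,H\in(\mathbb S^{n\times n})^g$ let $p(X)$ be the evaluation of $p$ at $X$, and let $p'(X)[H]$ and $p''(X)[H]$ be the first and second derivatives of $p(X+tH)$ in $t$ at $t=0$. The nc variety of $p$ is $$\mathcal V(p)=\bigcup_{n\ge 1}\{(X,v)\in(\mathbb S^{n\times n})^g\times\mathbb R^n : p(X)v=0\}.$$ A point $(X,v)\in\mathcal V(p)$, with $X$ of size $n$, is a full rank point of $p$ if the map $(\mathbb S^{n\times n})^g\to\mathbb R^n$, $H\mapsto p'(X)[H]v$, is onto. The variety $\mathcal V(p)$ has positive curvature at $(X,v)\in\mathcal V(p)$ if the clamped second fundamental form is nonnegative there, that is, $-\langle p''(X)[H]v,v\rangle\ge 0$ for every $H\in(\mathbb S^{n\times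 n})^g$ with $p'(X)[H]v=0$. An nc basic open semialgebraic set is a sequence $\mathcal O=(\mathcal O(n))_{n\ge1}$ of the form $\mathcal O(n)=\{X\in(\mathbb S^{n\times n})^g: q_1(X)\succ0,\dots,q_k(X)\succ0\}$, with $q_1,\dots,q_k$ symmetric nc polynomials. A symmetric nc polynomial $p$ is a minimum degree defining polynomial for a nonempty set $\mathcal D\subseteq\mathcal V(p)$ if every nonzero (not necessarily symmetric) nc polynomial $q$ with $q(X)v=0$ for all $(X,v)\in\mathcal D$ satisfies $\deg q\ge\deg p$. Finally, $p$ is concave if $p(tX+(1-t)Y)-tp(X)-(1-t)p(Y)\succeq0$ for all $n\ge1$, all $X,Y\in(\mathbb S^{n\times n})^g$ and all $0\le t\le1$. **Theorem.** Let $p$ be a symmetric nc polynomial in $g$ variables, let $\mathcal O$ be an nc basic open semialgebraic set, and let $\mathcal R$ be the set of full rank points $(X,v)$ of $p$ with $X\in\mathcal O$. Suppose that 1. $\mathcal R$ is nonempty; 2. $\mathcal V(p)$ has positive curvature at each point of $\mathcal R$; and 3. $p$ is a minimum degree defining polynomial for $\mathcal R$. Then $\deg p\le 2$ and $p$ is concave.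 -/

import Mathlib

open scoped Matrix

noncomputable section

/-- Noncommutative (nc) polynomials `ℝ<x₁,…,x_g>`: the free associative `ℝ`-algebra on `g`
letters.  Its `star` is the involution that reverses words and fixes the letters. -/
abbrev NCPoly (g : ℕ) : Type := FreeAlgebra ℝ (Fin g)

/-- `p` is symmetric: it is fixed by the involution that reverses words. -/
def NCPoly.IsSymmetric {g : ℕ} (p : NCPoly g) : Prop := star p = p

/-- The degree of `p`: the length of the longest word that appears in `p`
(and `0` for the zero polynomial). -/
def NCPoly.deg {g : ℕ} (p : NCPoly g) : ℕ :=
  (FreeAlgebra.equivMonoidAlgebraFreeMonoid p).coeff.support.sup FreeMonoid.length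

/-- `g`-tuples of real `n × n` matrices. -/
abbrev MatTuple (g n : ℕ) : Type := Fin g → Matrix (Fin n) (Fin n) ℝ

/-- The set of `g`-tuples of symmetric real `n × n` matrices. -/
def SymTuple (g n : ℕ) : Set (MatTuple g n) := {X | ∀ i, (X i).IsSymm}

/-- The evaluation `p(X)`: replace each letter `x_i` by the matrix `X_i`. -/
def NCPoly.evalAt {g n : ℕ} (p : NCPoly g) (X : MatTuple g n) : Matrix (Fin n) (Fin n) ℝ :=
  FreeAlgebra.lift ℝ X p

/-- `p(x + t h)` as a polynomial in a central variable `t` whose coefficients are nc polynomials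
in the letters `x_i` (`Sum.inl i`) and `h_i` (`Sum.inr i`). -/
def NCPoly.alongLine {g : ℕ} (p : NCPoly g) : Polynomial (FreeAlgebra ℝ (Fin g ⊕ Fin g)) :=
  FreeAlgebra.lift ℝ (fun i : Fin g =>
    Polynomial.C (FreeAlgebra.ι ℝ (Sum.inl i)) +
      Polynomial.X * Polynomial.C (FreeAlgebra.ι ℝ (Sum.inr i))) p

/-- The `l`-th directional derivative `p^{(l)}(x)[h]`, i.e. the `l`-th derivative of `p(x + t h)`
in `t` at `t = 0`, as an nc polynomial in the letters `x_i` and `h_i`. -/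
def NCPoly.dirDeriv {g : ℕ} (l : ℕ) (p : NCPoly g) : FreeAlgebra ℝ (Fin g ⊕ Fin g) :=
  ((Polynomial.derivative (R := FreeAlgebra ℝ (Fin g ⊕ Fin g)))^[l] p.alongLine).eval 0

/-- The value `p^{(l)}(X)[H]` of the `l`-th directional derivative. -/
def NCPoly.dirDerivAt {g n : ℕ} (l : ℕ) (p : NCPoly g) (X H : MatTuple g n) :
    Matrix (Fin n) (Fin n) ℝ :=
  FreeAlgebra.lift ℝ (Sum.elim X H) (p.dirDeriv l)

/-- `p` is (matrix) convex:
`t p(X) + (1 - t) p(Y) - p(t X + (1 - t) Y) ⪰ 0` for all sizes `n ≥ 1`, all tuples `X, Y` of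
symmetric `n × n` matrices and all `0 ≤ t ≤ 1`. -/
def NCPoly.IsConvex {g : ℕ} (p : NCPoly g) : Prop :=
  ∀ n : ℕ, 0 < n → ∀ X ∈ SymTuple g n, ∀ Y ∈ SymTuple g n, ∀ t : ℝ, 0 ≤ t → t ≤ 1 →
    (t • p.evalAt X + (1 - t) • p.evalAt Y - p.evalAt (t • X + (1 - t) • Y)).PosSemidef

/-- `p` is (matrix) concave: `-p` is convex. -/
def NCPoly.IsConcave {g : ℕ} (p : NCPoly g) : Prop := NCPoly.IsConvex (-p)

/-- An nc basic open semialgebraic set: a sequence `(O(n))_{n ≥ 1}` of the form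
`O(n) = {X symmetric : p₁(X) ≻ 0, …, p_k(X) ≻ 0}` for finitely many symmetric nc polynomials. -/
def IsNCBasicOpenSemialgebraic {g : ℕ} (O : ∀ n : ℕ, Set (MatTuple g n)) : Prop :=
  ∃ (k : ℕ) (q : Fin k → NCPoly g), (∀ j, (q j).IsSymmetric) ∧
    ∀ n : ℕ, 0 < n → O n = {X | X ∈ SymTuple g n ∧ ∀ j, ((q j).evalAt X).PosDef}

/-- A pair `(X, v)`: a `g`-tuple of symmetric `n × n` matrices and a vector in `ℝⁿ`, for some
`n ≥ 1`. -/
structure NCPoint (g : ℕ) where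
  size : ℕ
  size_pos : 0 < size
  mat : MatTuple g size
  symm : mat ∈ SymTuple g size
  vec : Fin size → ℝ

/-- The nc variety `V(p)`: all pairs `(X, v)` with `p(X) v = 0`. -/
def ncVariety {g : ℕ} (p : NCPoly g) : Set (NCPoint g) :=
  {P | p.evalAt P.mat *ᵥ P.vec = 0}

/-- The clamped tangent plane at `(X, v)`: all symmetric `H` with `p'(X)[H] v = 0`. -/
def clampedTangentPlane {g : ℕ} (p : NCPoly g) (P : NCPoint g) : Set (MatTuple g P.size) :=
  {H | H ∈ SymTuple g P.size ∧ p.dirDerivAt 1 P.mat H *ᵥ P.vec = 0}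

/-- The clamped second fundamental form at `(X, v)`: `H ↦ -⟨p''(X)[H] v, v⟩`. -/
def clampedSecondFundamentalForm {g : ℕ} (p : NCPoly g) (P : NCPoint g)
    (H : MatTuple g P.size) : ℝ :=
  -((p.dirDerivAt 2 P.mat H *ᵥ P.vec) ⬝ᵥ P.vec)

/-- `V(p)` has positive curvature at `(X, v)`: the clamped second fundamental form is nonnegative
on the clamped tangent plane. -/
def HasPositiveCurvatureAt {g : ℕ} (p : NCPoly g) (P : NCPoint g) : Prop :=
  ∀ H ∈ clampedTangentPlane p P, 0 ≤ clampedSecondFundamentalForm p P H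

/-- `(X, v)` is a full rank point of `p`: it lies on `V(p)`, and `H ↦ p'(X)[H] v` maps the
symmetric tuples onto `ℝⁿ`. -/
def IsFullRankPoint {g : ℕ} (p : NCPoly g) (P : NCPoint g) : Prop :=
  P ∈ ncVariety p ∧
    Set.SurjOn (fun H => p.dirDerivAt 1 P.mat H *ᵥ P.vec) (SymTuple g P.size) Set.univ

/-- The full rank points `(X, v)` of `p` with `X ∈ O`. -/
def fullRankPoints {g : ℕ} (p : NCPoly g) (O : ∀ n : ℕ, Set (MatTuple g n)) :
    Set (NCPoint g) :=
  {P | IsFullRankPoint p P ∧ P.mat ∈ O P.size}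

/-- The symmetric nc polynomial `p` is a minimum degree defining polynomial for the nonempty set
`D ⊆ V(p)`: every nonzero, not necessarily symmetric, nc polynomial `q` with `q(X) v = 0` for all
`(X, v) ∈ D` has degree at least that of `p`. -/
def IsMinDegDefiningPoly {g : ℕ} (p : NCPoly g) (D : Set (NCPoint g)) : Prop :=
  p.IsSymmetric ∧ D.Nonempty ∧ D ⊆ ncVariety p ∧
    ∀ q : NCPoly g, q ≠ 0 → (∀ P ∈ D, q.evalAt P.mat *ᵥ P.vec = 0) → p.deg ≤ q.deg

end

/-!
Let `d = deg p`, and let `(X, v)` be a full rank point with `X` in the semialgebraic set.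

Minimality of the degree says that no nonzero polynomial of degree less than `d` vanishes at all
full rank points.  Since full rank points are closed under direct sums, there is a single full rank
point at which the vectors `w(X) v`, for words `w` of length less than `d`, are linearly independent
(`exists_linearIndependent_words`).

Curvature is tested at `(X ⊕ X, v ⊕ 0)`, which is again a full rank point, in the symmetric
directions with off-diagonal blocks `Kᵢᵀ, Kᵢ`.  Here the `Kᵢ` are arbitrary square matrices, so the
vectors `y(i, w) = Kᵢ w(X) v` with `|w| < d` are arbitrary.  The first derivative is linear and the
second derivative is quadratic in `y`; they are given word by word by `firstForm` and `secondForm`.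
If `i₀ w₀` is a word of length `d` that occurs in `p`, then `y(i₀, w₀)` enters the first derivative
with a nonzero constant coefficient and does not enter the second one.  It can thus be chosen to
make the direction tangent, and the second derivative is nonpositive for all `y`
(`sum_coef_secondForm_nonpos`).

If `d ≥ 3`, let `i₀ j₀ γ₀` be a word of length `d` with coefficient `c ≠ 0` in `p`, and take
`y(i₀, 1) = a`, `y(j₀, γ₀) = s a` and all other `y` zero.  The second derivative form is then affine
in `s` with slope `2 c ⟨a, a⟩`, because `γ₀ᵀ j₀ i₀` also has coefficient `c`; it takes
positive values, a contradiction (`deg_le_two_of_secondForm_nonpos`).  If `d ≤ 2`, the form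
is the quadratic form of the degree two part of `p`, whose nonpositivity is concavity
(`isConcave_of_secondForm_nonpos`).
-/

/-! ### Words and coefficients -/

namespace NCPoly

variable {g : ℕ}

/-- The monomial `x_{i₁} ⋯ x_{i_k}` of the word `[i₁, …, i_k]`. -/
noncomputable def word (w : List (Fin g)) : NCPoly g := (w.map (FreeAlgebra.ι ℝ)).prod

@[simp] lemma word_nil : word ([] : List (Fin g)) = 1 := rfl

@[simp] lemma word_cons (i : Fin g) (w : List (Fin g)) :
    word (i :: w) = FreeAlgebra.ι ℝ i * word w := by simp [word]

lemma word_append (u w : List (Fin g)) : word (u ++ w) = word u * word w := by simp [word]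

/-- The coefficients of an nc polynomial, as a finitely supported function on words. -/
noncomputable def coef : NCPoly g ≃ₗ[ℝ] (List (Fin g) →₀ ℝ) :=
  (FreeAlgebra.equivMonoidAlgebraFreeMonoid.toLinearEquiv.trans
    (MonoidAlgebra.coeffLinearEquiv ℝ)).trans (Finsupp.domLCongr FreeMonoid.toList)

lemma coef_word (w : List (Fin g)) : coef (word w) = Finsupp.single w 1 := by
  have h : FreeAlgebra.equivMonoidAlgebraFreeMonoid (word w) =
      MonoidAlgebra.single (FreeMonoid.ofList w) (1 : ℝ) := by
    induction w with
    | nil => simp [MonoidAlgebra.one_def]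
    | cons i w ih =>
      rw [word_cons, map_mul, ih]
      simp [FreeAlgebra.equivMonoidAlgebraFreeMonoid, MonoidAlgebra.single_mul_single,
        FreeMonoid.ofList_cons]
  simp [coef, h]

lemma coef_symm_single (w : List (Fin g)) (c : ℝ) :
    coef.symm (Finsupp.single w c) = c • word w := by
  rw [LinearEquiv.symm_apply_eq, map_smul, coef_word, Finsupp.smul_single_one]

lemma linearMap_apply_eq_sum {M : Type*} [AddCommMonoid M] [Module ℝ M]
    (f : NCPoly g →ₗ[ℝ] M) (p : NCPoly g) :
    f p = ∑ w ∈ (coef p).support, coef p w • f (word w) := by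
  conv_lhs => rw [← coef.symm_apply_apply p, ← Finsupp.sum_single (coef p)]
  simp [Finsupp.sum, map_sum, coef_symm_single]

lemma deg_eq_sup (p : NCPoly g) : p.deg = (coef p).support.sup List.length := by
  unfold deg
  apply le_antisymm
  · refine Finset.sup_le fun w hw => ?_
    refine Finset.le_sup (f := List.length) (b := FreeMonoid.toList w) ?_
    simpa [coef] using hw
  · refine Finset.sup_le fun w hw => ?_
    refine Finset.le_sup (f := FreeMonoid.length) (b := FreeMonoid.ofList w) ?_
    simpa [coef] using hw

lemma length_le_deg {p : NCPoly g} {w : List (Fin g)} (hw : w ∈ (coef p).support) :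
    w.length ≤ p.deg := by
  rw [deg_eq_sup]
  exact Finset.le_sup hw

/-- The involution reverses the words that carry the coefficients. -/
lemma coef_star (p : NCPoly g) (w : List (Fin g)) : coef (star p) w = coef p w.reverse := by
  have hstar : ∀ u : List (Fin g), star (word u) = word u.reverse := by
    intro u
    induction u with
    | nil => simp
    | cons i u ih => simp [star_mul, ih, word_append]
  let S : NCPoly g →ₗ[ℝ] NCPoly g :=
    { toFun := star
      map_add' := star_add
      map_smul' := fun c q => by
        rw [Algebra.smul_def, star_mul, FreeAlgebra.star_algebraMap, RingHom.id_apply,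
          Algebra.smul_def, Algebra.commutes] }
  have h1 := linearMap_apply_eq_sum
    ((Finsupp.lapply w).comp (coef.toLinearMap.comp S)) p
  have h2 := linearMap_apply_eq_sum ((Finsupp.lapply w.reverse).comp coef.toLinearMap) p
  refine h1.trans (Eq.trans ?_ h2.symm)
  refine Finset.sum_congr rfl fun u _ => ?_
  have hS : S (word u) = word u.reverse := hstar u
  simp [hS, coef_word, Finsupp.single_apply, List.reverse_eq_iff]

end NCPoly

/-! ### Taylor coefficients of matrix evaluations -/

namespace NCPoly

variable {g : ℕ} {ι κ : Type*} [Fintype ι] [DecidableEq ι] [Fintype κ] [DecidableEq κ]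

/-- The coefficient of `t ^ k` in `p (X + t H)`, for matrices indexed by an arbitrary finite
type. -/
noncomputable def jet (k : ℕ) (X H : Fin g → Matrix ι ι ℝ) : NCPoly g →ₗ[ℝ] Matrix ι ι ℝ where
  toFun p := FreeAlgebra.lift ℝ (Sum.elim X H) (p.alongLine.coeff k)
  map_add' p q := by simp [alongLine]
  map_smul' c p := by simp [alongLine]

lemma alongLine_word_nil : alongLine (word ([] : List (Fin g))) = 1 := by simp [alongLine]

lemma alongLine_word_cons (i : Fin g) (w : List (Fin g)) :
    alongLine (word (i :: w)) = (Polynomial.C (FreeAlgebra.ι ℝ (Sum.inl i)) +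
      Polynomial.X * Polynomial.C (FreeAlgebra.ι ℝ (Sum.inr i))) * alongLine (word w) := by
  simp [alongLine]

lemma jet_zero_word (X H : Fin g → Matrix ι ι ℝ) (w : List (Fin g)) :
    jet 0 X H (word w) = FreeAlgebra.lift ℝ X (word w) := by
  induction w with
  | nil => simp [jet, alongLine_word_nil, -word_nil]; simp
  | cons i w ih =>
    simp only [jet, LinearMap.coe_mk, AddHom.coe_mk] at ih ⊢
    rw [alongLine_word_cons, add_mul, Polynomial.coeff_add, Polynomial.coeff_C_mul, mul_assoc,
      Polynomial.coeff_X_mul_zero, add_zero, map_mul, ih]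
    simp

@[simp] lemma jet_succ_word_nil (k : ℕ) (X H : Fin g → Matrix ι ι ℝ) :
    jet (k + 1) X H 1 = 0 := by
  simp [jet, alongLine, Polynomial.coeff_one]

lemma jet_succ_word_cons (k : ℕ) (X H : Fin g → Matrix ι ι ℝ) (i : Fin g) (w : List (Fin g)) :
    jet (k + 1) X H (word (i :: w)) =
      X i * jet (k + 1) X H (word w) + H i * jet k X H (word w) := by
  simp only [jet, LinearMap.coe_mk, AddHom.coe_mk]
  rw [alongLine_word_cons, add_mul, Polynomial.coeff_add, Polynomial.coeff_C_mul, mul_assoc,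
    Polynomial.coeff_X_mul, Polynomial.coeff_C_mul]
  simp

lemma lift_dirDeriv_one (X H : Fin g → Matrix ι ι ℝ) (p : NCPoly g) :
    FreeAlgebra.lift ℝ (Sum.elim X H) (p.dirDeriv 1) = jet 1 X H p := by
  simp [jet, dirDeriv, ← Polynomial.coeff_zero_eq_eval_zero, Polynomial.coeff_derivative]

lemma lift_dirDeriv_two (X H : Fin g → Matrix ι ι ℝ) (p : NCPoly g) :
    FreeAlgebra.lift ℝ (Sum.elim X H) (p.dirDeriv 2) = 2 • jet 2 X H p := by
  simp [jet, dirDeriv, ← Polynomial.coeff_zero_eq_eval_zero, Polynomial.coeff_derivative,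
    mul_two, two_smul, one_add_one_eq_two]

/-- Evaluation at block diagonal tuples is block diagonal. -/
lemma lift_fromBlocks_diag {σ : Type*} (X : σ → Matrix ι ι ℝ) (Y : σ → Matrix κ κ ℝ)
    (q : FreeAlgebra ℝ σ) :
    FreeAlgebra.lift ℝ (fun i => Matrix.fromBlocks (X i) 0 0 (Y i)) q =
      Matrix.fromBlocks (FreeAlgebra.lift ℝ X q) 0 0 (FreeAlgebra.lift ℝ Y q) := by
  induction q using FreeAlgebra.induction with
  | grade0 r =>
    simp [Algebra.algebraMap_eq_smul_one, ← Matrix.fromBlocks_one, Matrix.fromBlocks_smul]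
  | grade1 i => simp
  | mul a b ha hb => simp [ha, hb, Matrix.fromBlocks_multiply]
  | add a b ha hb => simp [ha, hb, Matrix.fromBlocks_add]

lemma lift_reindex {σ : Type*} (e : ι ≃ κ) (X : σ → Matrix ι ι ℝ) (q : FreeAlgebra ℝ σ) :
    FreeAlgebra.lift ℝ (fun i => Matrix.reindex e e (X i)) q =
      Matrix.reindex e e (FreeAlgebra.lift ℝ X q) := by
  have h : FreeAlgebra.lift ℝ (fun i => Matrix.reindex e e (X i)) =
      (Matrix.reindexAlgEquiv ℝ ℝ e : Matrix ι ι ℝ →ₐ[ℝ] Matrix κ κ ℝ).comp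
        (FreeAlgebra.lift ℝ X) :=
    FreeAlgebra.hom_ext (by ext; simp)
  rw [h]
  simp

lemma jet_fromBlocks_diag (k : ℕ) (X A : Fin g → Matrix ι ι ℝ) (Y B : Fin g → Matrix κ κ ℝ)
    (p : NCPoly g) :
    jet k (fun i => Matrix.fromBlocks (X i) 0 0 (Y i))
      (fun i => Matrix.fromBlocks (A i) 0 0 (B i)) p =
      Matrix.fromBlocks (jet k X A p) 0 0 (jet k Y B p) := by
  have h : Sum.elim (fun i => Matrix.fromBlocks (X i) 0 0 (Y i))
      (fun i => Matrix.fromBlocks (A i) 0 0 (B i)) =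
      fun s => Matrix.fromBlocks (Sum.elim X A s) 0 0 (Sum.elim Y B s) := by
    ext s : 1; cases s <;> rfl
  simp only [jet, LinearMap.coe_mk, AddHom.coe_mk, h, lift_fromBlocks_diag]

lemma jet_reindex (k : ℕ) (e : ι ≃ κ) (X H : Fin g → Matrix ι ι ℝ) (p : NCPoly g) :
    jet k (fun i => Matrix.reindex e e (X i)) (fun i => Matrix.reindex e e (H i)) p =
      Matrix.reindex e e (jet k X H p) := by
  have h : Sum.elim (fun i => Matrix.reindex e e (X i)) (fun i => Matrix.reindex e e (H i)) =
      fun s => Matrix.reindex e e (Sum.elim X H s) := by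
    ext s : 1; cases s <;> rfl
  simp only [jet, LinearMap.coe_mk, AddHom.coe_mk, h, lift_reindex]

/-- At a doubled tuple `X ⊕ X` the first derivative acts on each block of the direction. -/
lemma jet_one_fromBlocks (X A B C D : Fin g → Matrix ι ι ℝ) (p : NCPoly g) :
    jet 1 (fun i => Matrix.fromBlocks (X i) 0 0 (X i))
      (fun i => Matrix.fromBlocks (A i) (B i) (C i) (D i)) p =
      Matrix.fromBlocks (jet 1 X A p) (jet 1 X B p) (jet 1 X C p) (jet 1 X D p) := by
  have hword : ∀ w : List (Fin g), jet 1 (fun i => Matrix.fromBlocks (X i) 0 0 (X i))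
      (fun i => Matrix.fromBlocks (A i) (B i) (C i) (D i)) (word w) =
      Matrix.fromBlocks (jet 1 X A (word w)) (jet 1 X B (word w)) (jet 1 X C (word w))
        (jet 1 X D (word w)) := by
    intro w
    induction w with
    | nil => simp
    | cons i w ih =>
      simp only [jet_succ_word_cons 0, zero_add, jet_zero_word, lift_fromBlocks_diag] at ih ⊢
      simp [ih, Matrix.fromBlocks_multiply, Matrix.fromBlocks_add]
  simp only [linearMap_apply_eq_sum (jet 1 _ _) p, hword]
  induction (coef p).support using Finset.induction_on with
  | empty => simp
  | insert w s hw ih =>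
    rw [Finset.sum_insert hw, ih, Matrix.fromBlocks_smul, Matrix.fromBlocks_add]
    simp only [Finset.sum_insert hw]

end NCPoly

/-! ### Full rank points over arbitrary finite index types -/

namespace NCPoly

section BlockMatrices

lemma isSymm_fromBlocks_diag {ι κ : Type*} {A : Matrix ι ι ℝ} {B : Matrix κ κ ℝ} (hA : A.IsSymm)
    (hB : B.IsSymm) : (Matrix.fromBlocks A 0 0 B).IsSymm :=
  Matrix.IsSymm.fromBlocks hA (by simp) hB

variable {ι κ : Type*} [Fintype ι] [Fintype κ]

lemma reindex_mulVec_comp (e : ι ≃ κ) (M : Matrix ι ι ℝ) (v : ι → ℝ) :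
    Matrix.reindex e e M *ᵥ (v ∘ e.symm) = (M *ᵥ v) ∘ e.symm := by
  rw [Matrix.reindex_apply, Matrix.submatrix_mulVec_equiv]
  congr 2
  ext; simp

lemma posDef_fromBlocks_diag {A : Matrix ι ι ℝ} {B : Matrix κ κ ℝ} (hA : A.PosDef)
    (hB : B.PosDef) : (Matrix.fromBlocks A 0 0 B).PosDef := by
  refine .of_dotProduct_mulVec_pos (Matrix.IsHermitian.fromBlocks hA.1 (by simp) hB.1)
    fun x hx => ?_
  obtain ⟨y, z, rfl⟩ : ∃ y z, x = Sum.elim y z := ⟨x ∘ Sum.inl, x ∘ Sum.inr, by simp⟩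
  have h : star (Sum.elim y z) ⬝ᵥ Matrix.fromBlocks A 0 0 B *ᵥ Sum.elim y z =
      star y ⬝ᵥ A *ᵥ y + star z ⬝ᵥ B *ᵥ z := by
    have hs : star (Sum.elim y z) = Sum.elim (star y) (star z) := by ext (i | i) <;> rfl
    rw [hs, Matrix.fromBlocks_mulVec]
    simp [sumElim_dotProduct_sumElim]
  rw [h]
  by_cases hy : y = 0
  · have hz : z ≠ 0 := by
      rintro rfl
      exact hx (by subst hy; ext (i | i) <;> rfl)
    exact add_pos_of_nonneg_of_pos (hA.posSemidef.dotProduct_mulVec_nonneg y)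
      (hB.dotProduct_mulVec_pos hz)
  · exact add_pos_of_pos_of_nonneg (hA.dotProduct_mulVec_pos hy)
      (hB.posSemidef.dotProduct_mulVec_nonneg z)

lemma fromBlocks_mulVec_elim (A B C D : Matrix ι ι ℝ) (v w : ι → ℝ) :
    Matrix.fromBlocks A B C D *ᵥ Sum.elim v w =
      Sum.elim (A *ᵥ v + B *ᵥ w) (C *ᵥ v + D *ᵥ w) := by
  simp [Matrix.fromBlocks_mulVec]

lemma fromBlocks_diag_mulVec_elim (A : Matrix ι ι ℝ) (D : Matrix κ κ ℝ) (v : ι → ℝ)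
    (w : κ → ℝ) :
    Matrix.fromBlocks A 0 0 D *ᵥ Sum.elim v w = Sum.elim (A *ᵥ v) (D *ᵥ w) := by
  simp [Matrix.fromBlocks_mulVec]

end BlockMatrices

variable {g k : ℕ} {ι κ : Type*} [Fintype ι] [DecidableEq ι] [Fintype κ] [DecidableEq κ]

/-- `(X, v)`, indexed by an arbitrary finite type, is a full rank point of `p` at which all the
`q j` are positive definite.  Arbitrary index types make direct sums available without
renumbering. -/
structure IsRegularPoint (p : NCPoly g) (q : Fin k → NCPoly g) (X : Fin g → Matrix ι ι ℝ)
    (v : ι → ℝ) : Prop where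
  symm : ∀ i, (X i).IsSymm
  zero : FreeAlgebra.lift ℝ X p *ᵥ v = 0
  onto : ∀ b : ι → ℝ, ∃ H : Fin g → Matrix ι ι ℝ, (∀ i, (H i).IsSymm) ∧ jet 1 X H p *ᵥ v = b
  posDef : ∀ j, (FreeAlgebra.lift ℝ X (q j)).PosDef

variable {p : NCPoly g} {q : Fin k → NCPoly g}

namespace IsRegularPoint

variable {X : Fin g → Matrix ι ι ℝ} {v : ι → ℝ} {Y : Fin g → Matrix κ κ ℝ} {w : κ → ℝ}

lemma reindex (h : IsRegularPoint p q X v) (e : ι ≃ κ) :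
    IsRegularPoint p q (fun i => Matrix.reindex e e (X i)) (v ∘ e.symm) where
  symm i := (h.symm i).submatrix _
  zero := by rw [lift_reindex, reindex_mulVec_comp, h.zero]; rfl
  onto b := by
    obtain ⟨H, hH, hb⟩ := h.onto (b ∘ e)
    refine ⟨fun i => Matrix.reindex e e (H i), fun i => (hH i).submatrix _, ?_⟩
    rw [jet_reindex, reindex_mulVec_comp, hb]
    ext; simp
  posDef j := by
    rw [lift_reindex]
    exact (h.posDef j).submatrix e.symm.injective

/-- Full rank points are closed under direct sums. -/
lemma directSum (h : IsRegularPoint p q X v) (h' : IsRegularPoint p q Y w) :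
    IsRegularPoint p q (fun i => Matrix.fromBlocks (X i) 0 0 (Y i)) (Sum.elim v w) where
  symm i := isSymm_fromBlocks_diag (h.symm i) (h'.symm i)
  zero := by
    rw [lift_fromBlocks_diag, fromBlocks_diag_mulVec_elim, h.zero, h'.zero]
    ext (i | i) <;> rfl
  onto b := by
    obtain ⟨H, hH, hb⟩ := h.onto (b ∘ Sum.inl)
    obtain ⟨H', hH', hb'⟩ := h'.onto (b ∘ Sum.inr)
    refine ⟨fun i => Matrix.fromBlocks (H i) 0 0 (H' i),
      fun i => isSymm_fromBlocks_diag (hH i) (hH' i), ?_⟩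
    rw [jet_fromBlocks_diag, fromBlocks_diag_mulVec_elim, hb, hb']
    simp
  posDef j := by
    rw [lift_fromBlocks_diag]
    exact posDef_fromBlocks_diag (h.posDef j) (h'.posDef j)

/-- The point `(X ⊕ X, v ⊕ 0)` is again of full rank: directions with blocks `A, B, B, 0` reach
every vector. -/
lemma double (h : IsRegularPoint p q X v) :
    IsRegularPoint p q (fun i => Matrix.fromBlocks (X i) 0 0 (X i)) (Sum.elim v 0) where
  symm i := isSymm_fromBlocks_diag (h.symm i) (h.symm i)
  zero := by
    rw [lift_fromBlocks_diag, fromBlocks_diag_mulVec_elim, h.zero, Matrix.mulVec_zero]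
    ext (i | i) <;> rfl
  onto b := by
    obtain ⟨A, hA, hb⟩ := h.onto (b ∘ Sum.inl)
    obtain ⟨B, hB, hb'⟩ := h.onto (b ∘ Sum.inr)
    refine ⟨fun i => Matrix.fromBlocks (A i) (B i) (B i) 0,
      fun i => Matrix.IsSymm.fromBlocks (hA i) (hB i) (by simp [Matrix.IsSymm]), ?_⟩
    rw [jet_one_fromBlocks X A B B (fun _ => 0), fromBlocks_mulVec_elim, hb, hb']
    simp
  posDef j := by
    rw [lift_fromBlocks_diag]
    exact posDef_fromBlocks_diag (h.posDef j) (h.posDef j)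

end IsRegularPoint

variable {O : ∀ n : ℕ, Set (MatTuple g n)}

lemma isRegularPoint_of_mem
    (hO : ∀ n : ℕ, 0 < n → O n = {X | X ∈ SymTuple g n ∧ ∀ j, ((q j).evalAt X).PosDef})
    {P : NCPoint g} (hP : P ∈ fullRankPoints p O) : IsRegularPoint p q P.mat P.vec where
  symm := P.symm
  zero := hP.1.1
  onto b := by
    obtain ⟨H, hH, hb⟩ := hP.1.2 (Set.mem_univ b)
    exact ⟨H, hH, by rw [← lift_dirDeriv_one]; exact hb⟩
  posDef := by
    have h := hP.2
    rw [hO _ P.size_pos] at h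
    exact h.2

lemma mem_of_isRegularPoint
    (hO : ∀ n : ℕ, 0 < n → O n = {X | X ∈ SymTuple g n ∧ ∀ j, ((q j).evalAt X).PosDef})
    {P : NCPoint g} (hP : IsRegularPoint p q P.mat P.vec) : P ∈ fullRankPoints p O := by
  refine ⟨⟨hP.zero, fun b _ => ?_⟩, ?_⟩
  · obtain ⟨H, hH, hb⟩ := hP.onto b
    exact ⟨H, hH, by rw [← hb, ← lift_dirDeriv_one]; rfl⟩
  · rw [hO _ P.size_pos]
    exact ⟨P.symm, hP.posDef⟩

/-- Positive curvature, transferred to points over an arbitrary finite index type. -/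
lemma jet_two_nonpos
    (hO : ∀ n : ℕ, 0 < n → O n = {X | X ∈ SymTuple g n ∧ ∀ j, ((q j).evalAt X).PosDef})
    (hcurv : ∀ P ∈ fullRankPoints p O, HasPositiveCurvatureAt p P) [Nonempty ι]
    {X : Fin g → Matrix ι ι ℝ} {v : ι → ℝ} (h : IsRegularPoint p q X v)
    {H : Fin g → Matrix ι ι ℝ} (hH : ∀ i, (H i).IsSymm) (htan : jet 1 X H p *ᵥ v = 0) :
    (jet 2 X H p *ᵥ v) ⬝ᵥ v ≤ 0 := by
  have e := Fintype.equivFin ι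
  have h' := h.reindex e
  let P : NCPoint g := ⟨Fintype.card ι, Fintype.card_pos, _, h'.symm, v ∘ e.symm⟩
  let K : MatTuple g P.size := fun i => Matrix.reindex e e (H i)
  have hK : K ∈ clampedTangentPlane p P := by
    refine ⟨fun i => (hH i).submatrix _, ?_⟩
    rw [dirDerivAt, lift_dirDeriv_one]
    simp only [P, K]
    rw [jet_reindex, reindex_mulVec_comp, htan]
    rfl
  have hc := hcurv P (mem_of_isRegularPoint hO h') K hK
  rw [clampedSecondFundamentalForm, dirDerivAt, lift_dirDeriv_two] at hc
  simp only [P, K] at hc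
  rw [jet_reindex, Matrix.smul_mulVec, reindex_mulVec_comp, smul_dotProduct,
    comp_equiv_dotProduct_comp_equiv] at hc
  simp only [nsmul_eq_mul, Nat.cast_ofNat] at hc
  linarith

end NCPoly

/-! ### Linear independence of the vectors `w(X) v` -/

namespace NCPoly

variable {g k : ℕ} {ι κ : Type*} [Fintype ι] [DecidableEq ι] [Fintype κ] [DecidableEq κ]

/-- The linear map `q ↦ q(X) v`. -/
noncomputable def evalVec (X : Fin g → Matrix ι ι ℝ) (v : ι → ℝ) : NCPoly g →ₗ[ℝ] (ι → ℝ) where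
  toFun q := FreeAlgebra.lift ℝ X q *ᵥ v
  map_add' q r := by simp [Matrix.add_mulVec]
  map_smul' c q := by simp [Matrix.smul_mulVec]

lemma evalVec_apply (X : Fin g → Matrix ι ι ℝ) (v : ι → ℝ) (q : NCPoly g) :
    evalVec X v q = FreeAlgebra.lift ℝ X q *ᵥ v := rfl

lemma evalVec_directSum (X : Fin g → Matrix ι ι ℝ) (v : ι → ℝ) (Y : Fin g → Matrix κ κ ℝ)
    (w : κ → ℝ) (q : NCPoly g) :
    evalVec (fun i => Matrix.fromBlocks (X i) 0 0 (Y i)) (Sum.elim v w) q =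
      Sum.elim (evalVec X v q) (evalVec Y w q) := by
  simp only [evalVec_apply, lift_fromBlocks_diag, fromBlocks_diag_mulVec_elim]

/-- The nc polynomial of degree less than `d` with prescribed coefficients. -/
noncomputable def ofCoeffs (g d : ℕ) :
    ({w : List (Fin g) // w.length < d} →₀ ℝ) →ₗ[ℝ] NCPoly g :=
  Finsupp.linearCombination ℝ fun w => word w.1

lemma coef_ofCoeffs {d : ℕ} (a : {w : List (Fin g) // w.length < d} →₀ ℝ) :
    coef (ofCoeffs g d a) = Finsupp.mapDomain Subtype.val a := by
  simp [ofCoeffs, Finsupp.linearCombination_apply, Finsupp.mapDomain, Finsupp.sum, coef_word]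

lemma ofCoeffs_ne_zero {d : ℕ} {a : {w : List (Fin g) // w.length < d} →₀ ℝ} (ha : a ≠ 0) :
    ofCoeffs g d a ≠ 0 := by
  intro h
  apply ha
  apply Finsupp.mapDomain_injective Subtype.val_injective
  rw [← coef_ofCoeffs, h, map_zero, Finsupp.mapDomain_zero]

lemma deg_ofCoeffs_lt {d : ℕ} (hd : 0 < d) (a : {w : List (Fin g) // w.length < d} →₀ ℝ) :
    (ofCoeffs g d a).deg < d := by
  classical
  rw [deg_eq_sup, Finset.sup_lt_iff hd, coef_ofCoeffs]
  intro w hw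
  obtain ⟨u, -, rfl⟩ := Finset.mem_image.mp (Finsupp.mapDomain_support hw)
  exact u.2

variable {p : NCPoly g} {q : Fin k → NCPoly g} {O : ∀ n : ℕ, Set (MatTuple g n)}

/-- By minimality of the degree, every nonzero polynomial of degree less than `deg p` is nonzero
at some full rank point; a direct sum of finitely many such points is a full rank point at which
none of these polynomials vanishes. -/
theorem exists_linearIndependent_words
    (hO : ∀ n : ℕ, 0 < n → O n = {X | X ∈ SymTuple g n ∧ ∀ j, ((q j).evalAt X).PosDef})
    (hmin : IsMinDegDefiningPoly p (fullRankPoints p O)) (hd : 0 < p.deg) :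
    ∃ (ι : Type) (_ : Fintype ι) (_ : DecidableEq ι) (_ : Nonempty ι)
      (X : Fin g → Matrix ι ι ℝ) (v : ι → ℝ), IsRegularPoint p q X v ∧
      LinearIndependent ℝ fun w : {w : List (Fin g) // w.length < p.deg} =>
        evalVec X v (word w.1) := by
  have hfin : Finite {w : List (Fin g) // w.length < p.deg} :=
    (List.finite_length_lt (Fin g) p.deg).to_subtype
  -- descent on the dimension of the space of polynomials that vanish at the point
  suffices H : ∀ (n : ℕ) (ι : Type) [Fintype ι] [DecidableEq ι] [Nonempty ι]
      (X : Fin g → Matrix ι ι ℝ) (v : ι → ℝ), IsRegularPoint p q X v →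
      Module.finrank ℝ ((evalVec X v).comp (ofCoeffs g p.deg)).ker = n →
      ∃ (ι : Type) (_ : Fintype ι) (_ : DecidableEq ι) (_ : Nonempty ι)
        (X : Fin g → Matrix ι ι ℝ) (v : ι → ℝ), IsRegularPoint p q X v ∧
        LinearIndependent ℝ fun w : {w : List (Fin g) // w.length < p.deg} =>
          evalVec X v (word w.1) by
    obtain ⟨P, hP⟩ := hmin.2.1
    have : Nonempty (Fin P.size) := ⟨⟨0, P.size_pos⟩⟩
    exact H _ (Fin P.size) P.mat P.vec (isRegularPoint_of_mem hO hP) rfl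
  intro n
  induction n using Nat.strong_induction_on with
  | _ n ih =>
    intro ι _ _ _ X v hX hn
    by_cases hker : ((evalVec X v).comp (ofCoeffs g p.deg)).ker = ⊥
    · refine ⟨ι, inferInstance, inferInstance, inferInstance, X, v, hX, ?_⟩
      rw [LinearIndependent]
      convert! LinearMap.ker_eq_bot.mp hker using 1
      ext a : 1
      rw [LinearMap.comp_apply, ofCoeffs, Finsupp.apply_linearCombination]
      rfl
    · obtain ⟨a, ha, ha0⟩ := (Submodule.ne_bot_iff _).mp hker
      obtain ⟨P, hP, hPa⟩ : ∃ P ∈ fullRankPoints p O,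
          (ofCoeffs g p.deg a).evalAt P.mat *ᵥ P.vec ≠ 0 := by
        by_contra! hcon
        exact absurd (hmin.2.2.2 _ (ofCoeffs_ne_zero ha0) hcon)
          (not_le.mpr (deg_ofCoeffs_lt hd a))
      refine ih _ ?_ (ι ⊕ Fin P.size) _ _ (hX.directSum (isRegularPoint_of_mem hO hP)) rfl
      rw [← hn]
      apply Submodule.finrank_lt_finrank_of_lt
      rw [SetLike.lt_iff_le_and_exists]
      refine ⟨fun b hb => ?_, a, ha, fun hmem => hPa ?_⟩
      · rw [LinearMap.mem_ker, LinearMap.comp_apply, evalVec_directSum] at hb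
        rw [LinearMap.mem_ker, LinearMap.comp_apply]
        exact funext fun i => congr_fun hb (Sum.inl i)
      · rw [LinearMap.mem_ker, LinearMap.comp_apply, evalVec_directSum] at hmem
        exact funext fun i => congr_fun hmem (Sum.inr i)

end NCPoly

/-! ### The derivatives in an off-diagonal direction -/

namespace NCPoly

variable {g k : ℕ} {ι : Type*} [Fintype ι]

/-- The sum of `α(X) y(i, β)` over all factorizations `w = α i β`.  With `y(i, β) = Kᵢ β(X) v`
this is the first derivative of `w` at `X` in direction `K`, applied to `v`. -/
def firstForm (X : Fin g → Matrix ι ι ℝ) (y : Fin g → List (Fin g) → ι → ℝ) :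
    List (Fin g) → ι → ℝ
  | [] => 0
  | i :: w => X i *ᵥ firstForm X y w + y i w

/-- The sum of `⟨γ(X) y(j, δ), y(i, βᵀ α)⟩` over all factorizations `w = β i γ j δ`, where `α` is
an already reversed word that precedes `w`. -/
def secondForm (X : Fin g → Matrix ι ι ℝ) (y : Fin g → List (Fin g) → ι → ℝ) :
    List (Fin g) → List (Fin g) → ℝ
  | _, [] => 0
  | α, i :: w => secondForm X y (i :: α) w + firstForm X y w ⬝ᵥ y i α

/-- `firstForm` on words of length at most `d` sees `y(i, β)` for `β` shorter than `d` only. -/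
lemma firstForm_congr {X : Fin g → Matrix ι ι ℝ} {y z : Fin g → List (Fin g) → ι → ℝ} {d : ℕ}
    (h : ∀ i w, w.length < d → y i w = z i w) :
    ∀ w : List (Fin g), w.length ≤ d → firstForm X y w = firstForm X z w := by
  intro w
  induction w with
  | nil => simp [firstForm]
  | cons i w ih =>
    intro hw
    rw [List.length_cons] at hw
    rw [firstForm, firstForm, ih (by omega), h i w (by omega)]

/-- On words of total length at most `d`, `secondForm` does not see `y(i, β)` for `β` of length
at least `d - 1`: such a `β` leaves no letter for the second factor. -/
lemma secondForm_congr {X : Fin g → Matrix ι ι ℝ} {y z : Fin g → List (Fin g) → ι → ℝ} {d : ℕ}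
    (h : ∀ i w, w.length + 1 < d → y i w = z i w) :
    ∀ w α : List (Fin g), α.length + w.length ≤ d → secondForm X y α w = secondForm X z α w := by
  intro w
  induction w with
  | nil => simp [secondForm]
  | cons i w ih =>
    intro α hw
    rw [List.length_cons] at hw
    rw [secondForm, secondForm, ih (i :: α) (by rw [List.length_cons]; omega),
      firstForm_congr (d := d - 1) (fun j u hu => h j u (by omega)) w (by omega)]
    rcases w with _ | ⟨j, w⟩
    · simp [firstForm]
    · rw [List.length_cons] at hw
      rw [h i α (by omega)]

/-- The value `y(i₀, w₀)` at a word of top length enters `firstForm` only through `i₀ w₀`. -/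
lemma firstForm_add_top (X : Fin g → Matrix ι ι ℝ) (y : Fin g → List (Fin g) → ι → ℝ)
    (i₀ : Fin g) (w₀ : List (Fin g)) (z : ι → ℝ) (w : List (Fin g))
    (hw : w.length ≤ w₀.length + 1) :
    firstForm X (fun i u => y i u + if i :: u = i₀ :: w₀ then z else 0) w =
      firstForm X y w + if w = i₀ :: w₀ then z else 0 := by
  rcases w with _ | ⟨i, u⟩
  · simp [firstForm]
  · rw [List.length_cons] at hw
    rw [firstForm, firstForm, add_assoc]
    congr 2
    refine firstForm_congr (d := w₀.length) (fun j s hs => ?_) u (by omega)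
    have : j :: s ≠ i₀ :: w₀ := by
      rintro h
      obtain ⟨-, rfl⟩ := List.cons.inj h
      exact lt_irrefl _ hs
    simp [this]

variable [DecidableEq ι]

lemma jet_one_word_mulVec (X K : Fin g → Matrix ι ι ℝ) (v : ι → ℝ) (w : List (Fin g)) :
    jet 1 X K (word w) *ᵥ v =
      firstForm X (fun i u => K i *ᵥ evalVec X v (word u)) w := by
  induction w with
  | nil => simp [firstForm]
  | cons i w ih =>
    rw [jet_succ_word_cons 0, zero_add, jet_zero_word, Matrix.add_mulVec, ← Matrix.mulVec_mulVec,
      ← Matrix.mulVec_mulVec, ih, firstForm, evalVec_apply]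

lemma jet_one_word_double (X K : Fin g → Matrix ι ι ℝ) (v : ι → ℝ) (w : List (Fin g)) :
    jet 1 (fun i => Matrix.fromBlocks (X i) 0 0 (X i))
      (fun i => Matrix.fromBlocks 0 (K i)ᵀ (K i) 0) (word w) *ᵥ Sum.elim v 0 =
      Sum.elim (0 : ι → ℝ) (firstForm X (fun i u => K i *ᵥ evalVec X v (word u)) w) := by
  have h0 : jet 1 X (fun _ => 0) (word w) = 0 := by
    induction w with
    | nil => simp
    | cons i w ih => simp [jet_succ_word_cons 0, ih, -word_cons]
  rw [jet_one_fromBlocks X (fun _ => 0) (fun i => (K i)ᵀ) K (fun _ => 0),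
    fromBlocks_mulVec_elim, h0, jet_one_word_mulVec X K v]
  simp

/-- Half the second derivative of a word at `(X ⊕ X, v ⊕ 0)` in an off-diagonal direction.  The
accumulated word `α` comes from moving the symmetric `Xᵢ` to the other side of the inner product
one letter at a time. -/
lemma jet_two_word_double {X : Fin g → Matrix ι ι ℝ} (hX : ∀ i, (X i).IsSymm)
    (K : Fin g → Matrix ι ι ℝ) (v : ι → ℝ) (w α : List (Fin g)) :
    (jet 2 (fun i => Matrix.fromBlocks (X i) 0 0 (X i))
      (fun i => Matrix.fromBlocks 0 (K i)ᵀ (K i) 0) (word w) *ᵥ Sum.elim v 0) ⬝ᵥ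
        Sum.elim (evalVec X v (word α)) 0 =
      secondForm X (fun i u => K i *ᵥ evalVec X v (word u)) α w := by
  induction w generalizing α with
  | nil => simp [secondForm]
  | cons i w ih =>
    rw [secondForm, ← ih (i :: α), jet_succ_word_cons 1, Matrix.add_mulVec, add_dotProduct,
      one_add_one_eq_two, ← Matrix.mulVec_mulVec, ← Matrix.mulVec_mulVec, jet_one_word_double]
    have hsymm : (Matrix.fromBlocks (X i) 0 0 (X i))ᵀ = Matrix.fromBlocks (X i) 0 0 (X i) :=
      isSymm_fromBlocks_diag (hX i) (hX i)
    congr 1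
    · rw [dotProduct_comm, Matrix.dotProduct_mulVec, ← Matrix.mulVec_transpose, hsymm,
        fromBlocks_diag_mulVec_elim, dotProduct_comm, Matrix.mulVec_zero]
      simp [evalVec_apply, Matrix.mulVec_mulVec]
    · rw [fromBlocks_mulVec_elim, sumElim_dotProduct_sumElim]
      simp [Matrix.mulVec_transpose, Matrix.dotProduct_mulVec]

end NCPoly

/-! ### Positive curvature without the tangency constraint -/

namespace NCPoly

variable {g k : ℕ} {ι : Type*} [Fintype ι] [DecidableEq ι]

lemma exists_top_word {p : NCPoly g} (hd : 0 < p.deg) :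
    ∃ (i : Fin g) (w : List (Fin g)), (i :: w) ∈ (coef p).support ∧ w.length + 1 = p.deg := by
  have hne : (coef p).support.Nonempty := by
    rw [Finset.nonempty_iff_ne_empty]
    intro h
    rw [deg_eq_sup, h] at hd
    simp at hd
  obtain ⟨w, hw, hlen⟩ := Finset.exists_mem_eq_sup _ hne List.length
  rw [← deg_eq_sup] at hlen
  rcases w with _ | ⟨i, w⟩
  · simp at hlen; omega
  · exact ⟨i, w, hw, by simp [hlen]⟩

/-- Matrices with prescribed values on a linearly independent family. -/
lemma exists_matrix_mulVec {σ : Type*} {b : σ → ι → ℝ} (hb : LinearIndependent ℝ b)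
    (y : σ → ι → ℝ) : ∃ K : Matrix ι ι ℝ, ∀ s, K *ᵥ b s = y s := by
  obtain ⟨f, hf⟩ := LinearMap.exists_leftInverse_of_injective _ (LinearMap.ker_eq_bot.mpr hb)
  refine ⟨LinearMap.toMatrix' ((Finsupp.linearCombination ℝ y).comp f), fun s => ?_⟩
  have h := LinearMap.congr_fun hf (Finsupp.single s 1)
  simp only [LinearMap.comp_apply, Finsupp.linearCombination_single, one_smul,
    LinearMap.id_apply] at h
  rw [LinearMap.toMatrix'_mulVec, LinearMap.comp_apply, h, Finsupp.linearCombination_single,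
    one_smul]

variable {p : NCPoly g} {q : Fin k → NCPoly g} {O : ∀ n : ℕ, Set (MatTuple g n)}

/-- The tangency constraint costs nothing: the component `y(i₀, w₀)` at a word `i₀ w₀` of top
degree is invisible to the second derivative and can be chosen to solve the constraint.  So positive
curvature at the doubled point makes the second derivative form nonpositive for every `y`. -/
theorem sum_coef_secondForm_nonpos
    (hO : ∀ n : ℕ, 0 < n → O n = {X | X ∈ SymTuple g n ∧ ∀ j, ((q j).evalAt X).PosDef})
    (hcurv : ∀ P ∈ fullRankPoints p O, HasPositiveCurvatureAt p P) (hd : 0 < p.deg)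
    [Nonempty ι] {X : Fin g → Matrix ι ι ℝ} {v : ι → ℝ} (hX : IsRegularPoint p q X v)
    (hli : LinearIndependent ℝ fun w : {w : List (Fin g) // w.length < p.deg} =>
      evalVec X v (word w.1))
    (y : Fin g → List (Fin g) → ι → ℝ) :
    ∑ w ∈ (coef p).support, coef p w * secondForm X y [] w ≤ 0 := by
  obtain ⟨i₀, w₀, hmem, hlen⟩ := exists_top_word hd
  have hc : coef p (i₀ :: w₀) ≠ 0 := Finsupp.mem_support_iff.mp hmem
  obtain ⟨z, hz⟩ : ∃ z : ι → ℝ, coef p (i₀ :: w₀) • z +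
      ∑ w ∈ (coef p).support, coef p w • firstForm X y w = 0 :=
    ⟨-((coef p (i₀ :: w₀))⁻¹ • ∑ w ∈ (coef p).support, coef p w • firstForm X y w), by
      rw [smul_neg, smul_inv_smul₀ hc, neg_add_cancel]⟩
  let y' : Fin g → List (Fin g) → ι → ℝ := fun i u => y i u + if i :: u = i₀ :: w₀ then z else 0
  have hK : ∀ i, ∃ K : Matrix ι ι ℝ, ∀ w : {w : List (Fin g) // w.length < p.deg},
      K *ᵥ evalVec X v (word w.1) = y' i w.1 :=
    fun i => exists_matrix_mulVec hli fun w => y' i w.1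
  choose K hK using hK
  have hfirst : ∀ w ∈ (coef p).support,
      firstForm X (fun i u => K i *ᵥ evalVec X v (word u)) w =
        firstForm X y w + if w = i₀ :: w₀ then z else 0 := by
    intro w hw
    have hw' := length_le_deg hw
    rw [← firstForm_add_top X y i₀ w₀ z w (by omega)]
    exact firstForm_congr (fun i u hu => hK i ⟨u, hu⟩) w hw'
  have hsecond : ∀ w ∈ (coef p).support,
      secondForm X (fun i u => K i *ᵥ evalVec X v (word u)) [] w = secondForm X y [] w := by
    intro w hw
    refine secondForm_congr (d := p.deg) (fun i u hu => ?_) w [] (by simpa using length_le_deg hw)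
    rw [hK i ⟨u, by omega⟩]
    have : i :: u ≠ i₀ :: w₀ := by
      intro h
      obtain ⟨-, rfl⟩ := List.cons.inj h
      omega
    simp only [y', if_neg this, add_zero]
  have htan : jet 1 (fun i => Matrix.fromBlocks (X i) 0 0 (X i))
      (fun i => Matrix.fromBlocks 0 (K i)ᵀ (K i) 0) p *ᵥ Sum.elim v 0 = 0 := by
    rw [linearMap_apply_eq_sum (jet 1 _ _) p, Matrix.sum_mulVec]
    simp only [Matrix.smul_mulVec, jet_one_word_double]
    ext (i | i)
    · simp
    · have hsum : ∑ w ∈ (coef p).support, coef p w •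
          firstForm X (fun i u => K i *ᵥ evalVec X v (word u)) w = 0 := by
        rw [Finset.sum_congr rfl fun w hw => by rw [hfirst w hw, smul_add],
          Finset.sum_add_distrib, add_comm]
        refine Eq.trans ?_ hz
        simp only [smul_ite, smul_zero, Finset.sum_ite_eq', if_pos hmem]
      simpa using congr_fun hsum i
  have hneg := jet_two_nonpos hO hcurv hX.double
    (H := fun i => Matrix.fromBlocks 0 (K i)ᵀ (K i) 0)
    (fun i => Matrix.IsSymm.fromBlocks (by simp [Matrix.IsSymm])
      (Matrix.transpose_transpose _) (by simp [Matrix.IsSymm])) htan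
  rw [linearMap_apply_eq_sum (jet 2 _ _) p, Matrix.sum_mulVec, sum_dotProduct] at hneg
  refine le_of_eq_of_le (Finset.sum_congr rfl fun w hw => ?_) hneg
  rw [← hsecond w hw, ← jet_two_word_double hX.symm, Matrix.smul_mulVec, smul_dotProduct,
    smul_eq_mul, word_nil, evalVec_apply, map_one, Matrix.one_mulVec]

end NCPoly

/-! ### The degree bound -/

namespace NCPoly

variable {g : ℕ} {ι : Type*}

/-- The vectors `y(i₀, 1) = a`, `y(j₀, γ₀) = s a`, all others zero. -/
def twoPoint (a : ι → ℝ) (i₀ j₀ : Fin g) (γ₀ : List (Fin g)) (s : ℝ) :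
    Fin g → List (Fin g) → ι → ℝ :=
  fun i w => (if i = i₀ ∧ w = [] then a else 0) + s • (if i = j₀ ∧ w = γ₀ then a else 0)

lemma twoPoint_zero (a : ι → ℝ) (i₀ j₀ : Fin g) (γ₀ : List (Fin g)) (i : Fin g)
    (w : List (Fin g)) : twoPoint a i₀ j₀ γ₀ 0 i w = if i = i₀ ∧ w = [] then a else 0 := by
  simp [twoPoint]

lemma twoPoint_eq (a : ι → ℝ) (i₀ j₀ : Fin g) (γ₀ : List (Fin g)) (s : ℝ) (i : Fin g)
    (w : List (Fin g)) : twoPoint a i₀ j₀ γ₀ s i w =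
      twoPoint a i₀ j₀ γ₀ 0 i w + s • (if i = j₀ ∧ w = γ₀ then a else 0) := by
  simp [twoPoint]

variable [Fintype ι]

lemma firstForm_twoPoint (X : Fin g → Matrix ι ι ℝ) (a : ι → ℝ) (i₀ j₀ : Fin g)
    (γ₀ : List (Fin g)) (s : ℝ) (w : List (Fin g)) (hw : w.length ≤ γ₀.length + 1) :
    firstForm X (twoPoint a i₀ j₀ γ₀ s) w = firstForm X (twoPoint a i₀ j₀ γ₀ 0) w +
      s • (if w = j₀ :: γ₀ then a else 0) := by
  rcases w with _ | ⟨i, u⟩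
  · simp [firstForm]
  · rw [List.length_cons] at hw
    rw [firstForm, firstForm, twoPoint_eq a i₀ j₀ γ₀ s, add_assoc]
    congr 2
    · refine firstForm_congr (d := γ₀.length) (fun j t ht => ?_) u (by omega)
      have : t ≠ γ₀ := by rintro rfl; exact lt_irrefl _ ht
      simp [twoPoint, this]
    · simp

/-- In words of total length at most `|γ₀| + 2`, the parameter `s` enters `secondForm` linearly
and through the two words `i₀ j₀ γ₀` and `γ₀ᵀ j₀ i₀` only. -/
lemma secondForm_twoPoint (X : Fin g → Matrix ι ι ℝ) (a : ι → ℝ) (i₀ j₀ : Fin g)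
    {γ₀ : List (Fin g)} (hγ : γ₀ ≠ []) (s : ℝ) (w α : List (Fin g))
    (hw : α.length + w.length ≤ γ₀.length + 2) :
    secondForm X (twoPoint a i₀ j₀ γ₀ s) α w = secondForm X (twoPoint a i₀ j₀ γ₀ 0) α w +
      s * (a ⬝ᵥ a) * ((if α = [] ∧ w = i₀ :: j₀ :: γ₀ then 1 else 0) +
        (if α.reverse ++ w = γ₀.reverse ++ [j₀, i₀] ∧ α.length ≤ γ₀.length then 1 else 0)) := by
  have hγ' : 0 < γ₀.length := List.length_pos_of_ne_nil hγ
  induction w generalizing α with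
  | nil =>
    have h : ¬ (α.reverse = γ₀.reverse ++ [j₀, i₀] ∧ α.length ≤ γ₀.length) := by
      rintro ⟨h1, h2⟩
      have := congr_arg List.length h1
      simp at this
      omega
    simp only [secondForm, List.append_nil, h, reduceCtorEq, and_false, if_false,
      add_zero, mul_zero]
  | cons i w ih =>
    rw [List.length_cons] at hw
    have hstep : firstForm X (twoPoint a i₀ j₀ γ₀ s) w ⬝ᵥ twoPoint a i₀ j₀ γ₀ s i α =
        firstForm X (twoPoint a i₀ j₀ γ₀ 0) w ⬝ᵥ twoPoint a i₀ j₀ γ₀ 0 i α +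
        s * (a ⬝ᵥ a) * ((if α = [] ∧ i :: w = i₀ :: j₀ :: γ₀ then 1 else 0) +
          (if α = γ₀ ∧ i :: w = [j₀, i₀] then 1 else 0)) := by
      rw [firstForm_twoPoint X a i₀ j₀ γ₀ s w (by omega), twoPoint_eq a i₀ j₀ γ₀ s i α]
      by_cases h1 : w = j₀ :: γ₀
      · -- the length bound leaves the empty `α` only
        have hα : α = [] := by
          apply List.eq_nil_of_length_eq_zero
          rw [h1, List.length_cons] at hw
          omega
        subst hα h1
        by_cases h2 : i = i₀
        · simp [twoPoint_zero, hγ.symm, h2, add_dotProduct]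
        · simp [twoPoint_zero, hγ.symm, h2]
      · by_cases h2 : i = j₀ ∧ α = γ₀
        · obtain ⟨rfl, rfl⟩ := h2
          -- the length bound leaves words `w` with at most one letter
          rcases w with _ | ⟨l, w⟩
          · simp [firstForm, hγ]
          · have hw0 : w = [] := by
              apply List.eq_nil_of_length_eq_zero
              rw [List.length_cons] at hw
              omega
            subst hw0
            by_cases h3 : l = i₀
            · simp [firstForm, twoPoint_zero, hγ, h3, hγ.symm]
            · simp [firstForm, twoPoint_zero, hγ, h3, hγ.symm]
        · have h3 : ¬ (α = γ₀ ∧ i = j₀ ∧ w = [i₀]) := fun h => h2 ⟨h.2.1, h.1⟩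
          simp [h1, h2, h3]
    have hword : (if (i :: α).reverse ++ w = γ₀.reverse ++ [j₀, i₀] ∧
          (i :: α).length ≤ γ₀.length then (1 : ℝ) else 0) +
        (if α = γ₀ ∧ i :: w = [j₀, i₀] then 1 else 0) =
        if α.reverse ++ (i :: w) = γ₀.reverse ++ [j₀, i₀] ∧ α.length ≤ γ₀.length
          then 1 else 0 := by
      have hrev : (i :: α).reverse ++ w = α.reverse ++ (i :: w) := by simp
      rw [hrev, List.length_cons]
      rcases lt_trichotomy α.length γ₀.length with h | h | h
      · have hne : α ≠ γ₀ := by rintro rfl; exact lt_irrefl _ h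
        simp [hne, h.le, Nat.succ_le_of_lt h]
      · have hiff : α.reverse ++ (i :: w) = γ₀.reverse ++ [j₀, i₀] ↔
            α = γ₀ ∧ i :: w = [j₀, i₀] := by
          constructor
          · intro h'
            obtain ⟨h1, h2⟩ := List.append_inj h' (by simpa using h)
            exact ⟨List.reverse_injective h1, h2⟩
          · rintro ⟨rfl, h2⟩
            rw [h2]
        have hlt : ¬ (α.length + 1 ≤ γ₀.length) := by omega
        simp only [hiff, hlt, h.le, and_false, and_true, if_false, zero_add]
      · have hne : α ≠ γ₀ := by rintro rfl; exact lt_irrefl _ h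
        have hlt : ¬ (α.length + 1 ≤ γ₀.length) := by omega
        simp [hne, hlt, h.not_ge]
    rw [secondForm, secondForm, ih (i :: α) (by rw [List.length_cons]; omega), hstep, ← hword]
    simp only [reduceCtorEq, false_and, if_false]
    ring

/-- If the second derivative form of a symmetric `p` is nonpositive at all families of vectors,
then `p` has degree at most two: otherwise the family `twoPoint` makes the form a nonconstant
affine function of `s`. -/
theorem deg_le_two_of_secondForm_nonpos [Nonempty ι] {p : NCPoly g} (hp : p.IsSymmetric)
    (X : Fin g → Matrix ι ι ℝ) (h : ∀ y : Fin g → List (Fin g) → ι → ℝ,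
      ∑ w ∈ (coef p).support, coef p w * secondForm X y [] w ≤ 0) : p.deg ≤ 2 := by
  by_contra! hd
  obtain ⟨i₀, w₀, hmem, hlen⟩ := exists_top_word (show 0 < p.deg by omega)
  obtain ⟨j₀, γ₀, rfl⟩ : ∃ j γ, w₀ = j :: γ :=
    List.exists_cons_of_length_pos (by omega)
  rw [List.length_cons] at hlen
  have hγ : γ₀ ≠ [] := List.ne_nil_of_length_pos (by omega)
  have hc : coef p (i₀ :: j₀ :: γ₀) ≠ 0 := Finsupp.mem_support_iff.mp hmem
  have hrev : coef p (γ₀.reverse ++ [j₀, i₀]) = coef p (i₀ :: j₀ :: γ₀) := by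
    have := coef_star p (γ₀.reverse ++ [j₀, i₀])
    rw [hp] at this
    simpa using this
  let a : ι → ℝ := fun _ => 1
  have ha : 0 < a ⬝ᵥ a := by simp [a, dotProduct, Fintype.card_pos]
  set Q : ℝ := ∑ w ∈ (coef p).support, coef p w * secondForm X (twoPoint a i₀ j₀ γ₀ 0) [] w
  have hval : ∀ s : ℝ, ∑ w ∈ (coef p).support,
      coef p w * secondForm X (twoPoint a i₀ j₀ γ₀ s) [] w =
        Q + s * (2 * (a ⬝ᵥ a) * coef p (i₀ :: j₀ :: γ₀)) := by
    intro s
    have hterm : ∀ w ∈ (coef p).support,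
        coef p w * secondForm X (twoPoint a i₀ j₀ γ₀ s) [] w =
        coef p w * secondForm X (twoPoint a i₀ j₀ γ₀ 0) [] w + s * (a ⬝ᵥ a) *
          ((if w = i₀ :: j₀ :: γ₀ then coef p w else 0) +
            (if w = γ₀.reverse ++ [j₀, i₀] then coef p w else 0)) := by
      intro w hw
      have hw' := length_le_deg hw
      rw [secondForm_twoPoint X a i₀ j₀ hγ s w [] (by simp; omega)]
      simp only [List.reverse_nil, List.nil_append, List.length_nil, Nat.zero_le, and_true,
        true_and]
      split_ifs <;> ring
    rw [Finset.sum_congr rfl hterm, Finset.sum_add_distrib, ← Finset.mul_sum,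
      Finset.sum_add_distrib, Finset.sum_ite_eq', Finset.sum_ite_eq', if_pos hmem,
      if_pos (by rw [Finsupp.mem_support_iff, hrev]; exact hc), hrev]
    ring
  have hne : 2 * (a ⬝ᵥ a) * coef p (i₀ :: j₀ :: γ₀) ≠ 0 :=
    mul_ne_zero (by positivity) hc
  have h1 := h (twoPoint a i₀ j₀ γ₀ ((1 - Q) / (2 * (a ⬝ᵥ a) * coef p (i₀ :: j₀ :: γ₀))))
  rw [hval, div_mul_cancel₀ _ hne] at h1
  linarith

/-! ### Concavity in degree two -/

/-- The value `f i j` on the word `[i, j]`, and zero on words of any other length.  It turns sums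
over pairs of letters into sums over the words of an nc polynomial. -/
def quadWord {M : Type*} [Zero M] (f : Fin g → Fin g → M) : List (Fin g) → M
  | [i, j] => f i j
  | _ => 0

lemma secondForm_of_length_le_two [DecidableEq ι] (X : Fin g → Matrix ι ι ℝ)
    (y : Fin g → List (Fin g) → ι → ℝ) (w : List (Fin g)) (hw : w.length ≤ 2) :
    secondForm X y [] w = quadWord (fun i j => y j [] ⬝ᵥ y i []) w := by
  match w, hw with
  | [], _ => simp [secondForm, quadWord]
  | [i], _ => simp [secondForm, quadWord, firstForm]
  | [i, j], _ => simp [secondForm, quadWord, firstForm]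

lemma lift_word_convexity_defect [DecidableEq ι] (X Y : Fin g → Matrix ι ι ℝ) (t : ℝ)
    (w : List (Fin g)) (hw : w.length ≤ 2) :
    t • FreeAlgebra.lift ℝ X (word w) + (1 - t) • FreeAlgebra.lift ℝ Y (word w) -
      FreeAlgebra.lift ℝ (t • X + (1 - t) • Y) (word w) =
      (t * (1 - t)) • quadWord (fun i j => (X i - Y i) * (X j - Y j)) w := by
  match w, hw with
  | [], _ =>
    simp only [word_nil, map_one, quadWord]
    module
  | [i], _ => simp [quadWord]
  | [i, j], _ =>
    simp only [word_cons, word_nil, map_mul, FreeAlgebra.lift_ι_apply, quadWord, Pi.add_apply,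
      Pi.smul_apply, mul_one]
    simp only [mul_add, add_mul, mul_sub, sub_mul, smul_mul_assoc, mul_smul_comm]
    module

lemma isSymm_of_isSymmetric [DecidableEq ι] {p : NCPoly g} (hp : p.IsSymmetric)
    {X : Fin g → Matrix ι ι ℝ} (hX : ∀ i, (X i).IsSymm) :
    (FreeAlgebra.lift ℝ X p).IsSymm := by
  have h : ∀ r : NCPoly g, FreeAlgebra.lift ℝ X (star r) = (FreeAlgebra.lift ℝ X r)ᵀ := by
    intro r
    induction r using FreeAlgebra.induction with
    | grade0 c =>
      rw [FreeAlgebra.star_algebraMap, AlgHom.commutes, Algebra.algebraMap_eq_smul_one,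
        Matrix.transpose_smul, Matrix.transpose_one]
    | grade1 i => simp [(hX i).eq]
    | mul a b ha hb => simp [star_mul, ha, hb]
    | add a b ha hb => simp [ha, hb]
  rw [Matrix.IsSymm, ← h, hp]

/-- If the second derivative form of a symmetric `p` of degree at most two is nonpositive, so is
the quadratic form of its degree two part, and that form controls the defect of concavity. -/
theorem isConcave_of_secondForm_nonpos [Nonempty ι] [DecidableEq ι] {p : NCPoly g}
    (hp : p.IsSymmetric) (hd : p.deg ≤ 2) (X : Fin g → Matrix ι ι ℝ)
    (h : ∀ y : Fin g → List (Fin g) → ι → ℝ,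
      ∑ w ∈ (coef p).support, coef p w * secondForm X y [] w ≤ 0) : p.IsConcave := by
  have hquad : ∀ b : Fin g → ℝ,
      ∑ w ∈ (coef p).support, coef p w * quadWord (fun i j => b j * b i) w ≤ 0 := by
    intro b
    obtain ⟨i₁⟩ := ‹Nonempty ι›
    refine le_of_eq_of_le (Finset.sum_congr rfl fun w hw => ?_)
      (h fun i _ => Pi.single i₁ (b i))
    rw [secondForm_of_length_le_two X _ w ((length_le_deg hw).trans hd)]
    simp
  intro n _ A hA B hB t ht0 ht1
  have hS : ∀ {M : MatTuple g n}, M ∈ SymTuple g n → ((-p).evalAt M).IsSymm := by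
    intro M hM
    rw [evalAt, map_neg]
    exact (isSymm_of_isSymmetric hp hM).neg
  refine .of_dotProduct_mulVec_nonneg ?_ fun x => ?_
  · have hC : t • A + (1 - t) • B ∈ SymTuple g n := fun i =>
      ((hA i).smul t).add ((hB i).smul (1 - t))
    exact (((hS hA).smul t).add ((hS hB).smul (1 - t))).sub (hS hC)
  · let D : Fin g → Fin n → ℝ := fun i => (A i - B i) *ᵥ x
    let E : NCPoly g →ₗ[ℝ] Matrix (Fin n) (Fin n) ℝ :=
      t • (FreeAlgebra.lift ℝ A).toLinearMap + (1 - t) • (FreeAlgebra.lift ℝ B).toLinearMap -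
        (FreeAlgebra.lift ℝ (t • A + (1 - t) • B)).toLinearMap
    have hE : t • (-p).evalAt A + (1 - t) • (-p).evalAt B - (-p).evalAt (t • A + (1 - t) • B) =
        -∑ w ∈ (coef p).support, coef p w •
          ((t * (1 - t)) • quadWord (fun i j => (A i - B i) * (A j - B j)) w) := by
      have hEp : t • (-p).evalAt A + (1 - t) • (-p).evalAt B -
          (-p).evalAt (t • A + (1 - t) • B) = -E p := by
        simp only [evalAt, map_neg, E, LinearMap.sub_apply, LinearMap.add_apply,
          LinearMap.smul_apply, AlgHom.toLinearMap_apply]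
        module
      rw [hEp, linearMap_apply_eq_sum E p]
      congr 1
      refine Finset.sum_congr rfl fun w hw => ?_
      rw [← lift_word_convexity_defect A B t w ((length_le_deg hw).trans hd)]
      rfl
    have hx : ∀ w : List (Fin g),
        x ⬝ᵥ quadWord (fun i j => (A i - B i) * (A j - B j)) w *ᵥ x =
          ∑ m, quadWord (fun i j => D j m * D i m) w := by
      intro w
      match w with
      | [] => simp [quadWord]
      | [i] => simp [quadWord]
      | [i, j] =>
        simp only [quadWord]
        rw [← Matrix.mulVec_mulVec, Matrix.dotProduct_mulVec, ← Matrix.mulVec_transpose,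
          ((hA i).sub (hB i)).eq, dotProduct_comm]
        rfl
      | _ :: _ :: _ :: _ => simp [quadWord]
    rw [hE, Matrix.neg_mulVec, dotProduct_neg, Matrix.sum_mulVec, dotProduct_sum, star_trivial,
      neg_nonneg]
    have hrw : ∑ w ∈ (coef p).support, x ⬝ᵥ (coef p w •
        ((t * (1 - t)) • quadWord (fun i j => (A i - B i) * (A j - B j)) w)) *ᵥ x =
        (t * (1 - t)) * ∑ m, ∑ w ∈ (coef p).support,
          coef p w * quadWord (fun i j => D j m * D i m) w := by
      rw [Finset.sum_comm, Finset.mul_sum]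
      refine Finset.sum_congr rfl fun w _ => ?_
      rw [Matrix.smul_mulVec, Matrix.smul_mulVec, dotProduct_smul, dotProduct_smul, hx,
        ← Finset.mul_sum, smul_eq_mul, smul_eq_mul]
      ring
    rw [hrw]
    exact mul_nonpos_of_nonneg_of_nonpos (mul_nonneg ht0 (by linarith))
      (Finset.sum_nonpos fun m _ => hquad fun i => D i m)

end NCPoly

theorem mainTheorem4 (g : ℕ) (p : NCPoly g) (hp : p.IsSymmetric)
    (O : ∀ n : ℕ, Set (MatTuple g n)) (hO : IsNCBasicOpenSemialgebraic O)
    (hne : (fullRankPoints p O).Nonempty)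
    (hcurv : ∀ P ∈ fullRankPoints p O, HasPositiveCurvatureAt p P)
    (hmin : IsMinDegDefiningPoly p (fullRankPoints p O)) :
    p.deg ≤ 2 ∧ p.IsConcave := by
  obtain ⟨k, q, -, hq⟩ := hO
  have key : ∃ (ι : Type) (_ : Fintype ι) (_ : DecidableEq ι) (_ : Nonempty ι)
      (X : Fin g → Matrix ι ι ℝ), ∀ y : Fin g → List (Fin g) → ι → ℝ,
      ∑ w ∈ (NCPoly.coef p).support, NCPoly.coef p w * NCPoly.secondForm X y [] w ≤ 0 := by
    rcases Nat.eq_zero_or_pos p.deg with hd | hd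
    · -- the second derivative of a constant vanishes
      refine ⟨Fin 1, inferInstance, inferInstance, inferInstance, 0, fun y => le_of_eq ?_⟩
      refine Finset.sum_eq_zero fun w hw => ?_
      have hw' := NCPoly.length_le_deg hw
      rw [hd, Nat.le_zero, List.length_eq_zero_iff] at hw'
      simp [hw', NCPoly.secondForm]
    · obtain ⟨ι, _, _, _, X, v, hX, hli⟩ := NCPoly.exists_linearIndependent_words hq hmin hd
      exact ⟨ι, inferInstance, inferInstance, inferInstance, X,
        NCPoly.sum_coef_secondForm_nonpos hq hcurv hd hX hli⟩
  obtain ⟨ι, _, _, _, X, hX⟩ := key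
  have hd := NCPoly.deg_le_two_of_secondForm_nonpos hp X hX
  exact ⟨hd, NCPoly.isConcave_of_secondForm_nonpos hp hd X hX⟩
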